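/- Let $F$ be a field of characteristic $2$. A totally singular quadratic form over $F$ is a map $\varphi\colon V\to F$ on a finite-dimensional $F$-vector space $V$ with $\varphi(av)=a^2\varphi(v)$ and $\varphi(v+w)=\varphi(v)+\varphi(w)$ for all $a\in F$ and $v,w\in V$; put $\dim\varphi=\dim V$. It decomposes as $\varphi\simeq\varphi_{\mathrm{an}}\perp k\times\langle 0\rangle$ with $\varphi_{\mathrm{an}}$ anisotropic (that is, $\varphi_{\mathrm{an}}(v)=0$ only for $v=0$); the form $\varphi_{\mathrm{an}}$ is unique up to isometry, and $k$ is called the defect of $\varphi$. For a field extension $E/F$, let $\varphi_E$ be the totally singular form on $E\otimes_F V$ with $\varphi_E(e\otimes v)=e^2\varphi(v)$. An anisotropic totally singular form $\sigma$ of dimension at least $1$ is called minimal over $F$ if $[N_F(\sigma):F^2]=2^{\dim\sigma-1}$, where $N_F(\sigma)=F^2\bigl(\tfrac ab : a,b \text{ nonzero values of }\sigma\bigr)$. Two totally singular forms $\varphi,\psi$ over $F$ are called Vishik equivalent if $\dim\varphi=\dim\psi$ and $\varphi_E,\psi_E$ have the same defect for every field extension $E/F$; they are called weakly Vishik equivalent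 if $\dim\varphi=\dim\psi$ and $\varphi_E,\psi_E$ have the same defect for every $E=F(\sqrt a)$, $a\in F$. They are called similar if $\varphi\simeq c\psi$ (an isometry) for some $c\in F^*$. Theorem. Let $\varphi,\psi$ be totally singular quadratic forms over $F$ such that $\varphi_{\mathrm{an}}$ is minimal over $F$. If $\varphi$ and $\psi$ are weakly Vishik equivalent, then they are similar. In particular, if $\varphi$ and $\psi$ are Vishik equivalent, then they are similar. -/

import Mathlib

open scoped TensorProduct

universe u v w

namespace TSForm

section Basic

variable {F : Type u} [Field F] {V : Type v} [AddCommGroup V] [Module F V]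
  {W : Type w} [AddCommGroup W] [Module F W]

/-- A quadratic form is totally singular if its polar form vanishes identically, i.e. if it is
additive: `φ (v + w) = φ v + φ w`. -/
def IsTotallySingular (φ : QuadraticForm F V) : Prop :=
  ∀ v w : V, QuadraticMap.polar φ v w = 0

theorem IsTotallySingular.map_add {φ : QuadraticForm F V} (h : IsTotallySingular φ) (v w : V) :
    φ (v + w) = φ v + φ w := by
  have h' := h v w
  rw [QuadraticMap.polar, sub_sub, sub_eq_zero] at h'
  exact h'

theorem IsTotallySingular.mem_radical_iff {φ : QuadraticForm F V} (h : IsTotallySingular φ)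
    {v : V} : v ∈ φ.radical ↔ φ v = 0 := by
  rw [QuadraticMap.mem_radical_iff']
  refine ⟨fun h' => h'.1, fun h' => ⟨h', fun n => ?_⟩⟩
  rw [h.map_add, h', zero_add]

/-- Similarity: `φ ≃ c ψ` for some nonzero scalar `c`. -/
def Similar (φ : QuadraticForm F V) (ψ : QuadraticForm F W) : Prop :=
  ∃ c : F, c ≠ 0 ∧ QuadraticMap.Equivalent φ (c • ψ)

/-- The defect (quasilinear index) of `φ`: the dimension of its quadratic radical. For a totally
singular form this is the dimension of the subspace of zeros of `φ`, which is the number `k` in any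
decomposition `φ ≃ σ ⟂ k × ⟨0⟩` with `σ` anisotropic; see `equivalent_anisotropicPart_prod` and
`defect_eq_of_equivalent_prod`. -/
noncomputable def defect (φ : QuadraticForm F V) : ℕ :=
  Module.finrank F φ.radical

/-- The anisotropic part of `φ`: the form induced by `φ` on the quotient by its radical. -/
noncomputable def anisotropicPart (φ : QuadraticForm F V) : QuadraticForm F (V ⧸ φ.radical) :=
  QuadraticMap.lift φ φ.radical le_rfl

theorem anisotropicPart_anisotropic {φ : QuadraticForm F V} (h : IsTotallySingular φ) :
    (anisotropicPart φ).Anisotropic := by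
  intro x
  induction x using Submodule.Quotient.induction_on with
  | H v =>
    intro hv
    exact (Submodule.Quotient.mk_eq_zero _).mpr (h.mem_radical_iff.mpr hv)

/-- The decomposition `φ ≃ φ_an ⟂ k × ⟨0⟩` with `k` the defect of `φ`. -/
theorem equivalent_anisotropicPart_prod [FiniteDimensional F V] (φ : QuadraticForm F V) :
    QuadraticMap.Equivalent φ
      ((anisotropicPart φ).prod (0 : QuadraticForm F (Fin (defect φ) → F))) := by
  obtain ⟨q, hq⟩ := Submodule.exists_isCompl φ.radical
  let e₁ : V ≃ₗ[F] (q × φ.radical) := (Submodule.prodEquivOfIsCompl q φ.radical hq.symm).symm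
  let e₂ : q ≃ₗ[F] (V ⧸ φ.radical) := (Submodule.quotientEquivOfIsCompl φ.radical q hq).symm
  let e₃ : φ.radical ≃ₗ[F] (Fin (defect φ) → F) := (Module.finBasis F φ.radical).equivFun
  let e : V ≃ₗ[F] ((V ⧸ φ.radical) × (Fin (defect φ) → F)) := e₁.trans (e₂.prodCongr e₃)
  refine ⟨⟨e, fun v => ?_⟩⟩
  obtain ⟨⟨x, y⟩, rfl⟩ := e₁.symm.surjective v
  have hx : e (e₁.symm (x, y)) = (Submodule.Quotient.mk (x : V), e₃ y) := by
    simp [e, e₂]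
  have hv : e₁.symm (x, y) = (y : V) + (x : V) := by
    simp [e₁, add_comm]
  change ((anisotropicPart φ).prod 0) (e (e₁.symm (x, y))) = φ (e₁.symm (x, y))
  rw [hx, hv, (QuadraticMap.mem_radical_iff'.mp y.2).2 x]
  simp [anisotropicPart]

theorem defect_eq_of_equivalent_prod {φ : QuadraticForm F V} {σ : QuadraticForm F W} {k : ℕ}
    (hσ : σ.Anisotropic)
    (h : QuadraticMap.Equivalent φ (σ.prod (0 : QuadraticForm F (Fin k → F)))) :
    defect φ = k := by
  have hr : (σ.prod (0 : QuadraticForm F (Fin k → F))).radical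
      = LinearMap.range (LinearMap.inr F W (Fin k → F)) := by
    ext ⟨x, y⟩
    rw [QuadraticMap.mem_radical_iff']
    constructor
    · intro hx
      have : x = 0 := hσ x (by simpa using hx.1)
      exact ⟨y, by simp [this]⟩
    · rintro ⟨z, hz⟩
      have : x = 0 := (congrArg Prod.fst hz).symm
      simp [this]
  rw [defect, h.rank_radical_eq, hr, LinearMap.finrank_range_of_inj LinearMap.inr_injective]
  simp

end Basic

section Char2

variable {F : Type u} [Field F] [CharP F 2] {V : Type v} [AddCommGroup V] [Module F V]
  {W : Type w} [AddCommGroup W] [Module F W]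

/-- The additive map `E ⊗ V → E` with `e ⊗ v ↦ e ^ 2 * φ v`. -/
noncomputable def baseChangeHom (E : Type*) [Field E] [Algebra F E] (φ : QuadraticForm F V)
    (hφ : IsTotallySingular φ) : E ⊗[F] V →+ E :=
  haveI : CharP E 2 := charP_of_injective_algebraMap (algebraMap F E).injective 2
  TensorProduct.liftAddHom
    (AddMonoidHom.mk' (fun e => AddMonoidHom.mk' (fun v => e ^ 2 * algebraMap F E (φ v))
        (fun v w => by rw [hφ.map_add, map_add, mul_add]))
      (fun e e' => by ext v; simp [CharTwo.add_sq, add_mul]))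
    (fun r e v => by
      simp only [AddMonoidHom.mk'_apply, Algebra.smul_def r e, QuadraticMap.map_smul, smul_eq_mul,
        map_mul]
      ring)

/-- The scalar extension `φ_E` of a totally singular quadratic form `φ` over a field of
characteristic `2`: the form on `E ⊗ V` with `φ_E (e ⊗ v) = e ^ 2 * φ v`. -/
noncomputable def baseChange (E : Type*) [Field E] [Algebra F E] (φ : QuadraticForm F V)
    (hφ : IsTotallySingular φ) : QuadraticForm E (E ⊗[F] V) where
  toFun := baseChangeHom E φ hφ
  toFun_smul a x := by
    induction x using TensorProduct.induction_on with
    | zero => simp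
    | tmul e v =>
      simp only [baseChangeHom, TensorProduct.smul_tmul', TensorProduct.liftAddHom_tmul,
        AddMonoidHom.mk'_apply, smul_eq_mul]
      ring
    | add x y hx hy => rw [smul_add, map_add, hx, hy, map_add, smul_add]
  exists_companion' := ⟨0, fun x y => by simp⟩

theorem baseChange_tmul (E : Type*) [Field E] [Algebra F E] (φ : QuadraticForm F V)
    (hφ : IsTotallySingular φ) (e : E) (v : V) :
    baseChange E φ hφ (e ⊗ₜ[F] v) = e ^ 2 * algebraMap F E (φ v) := rfl

theorem baseChange_isTotallySingular (E : Type*) [Field E] [Algebra F E] (φ : QuadraticForm F V)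
    (hφ : IsTotallySingular φ) : IsTotallySingular (baseChange E φ hφ) := by
  intro x y
  rw [QuadraticMap.polar, sub_sub, sub_eq_zero]
  exact map_add (baseChangeHom E φ hφ) x y

/-- The field `F(√a)`, inside an algebraic closure of `F`. -/
noncomputable def sqrtExtension (a : F) : IntermediateField F (AlgebraicClosure F) :=
  IntermediateField.adjoin F {x | x ^ 2 = algebraMap F (AlgebraicClosure F) a}

/-- Vishik equivalence: equal dimensions, and equal defects over every field extension `E / F`. -/
def VishikEquivalent (φ : QuadraticForm F V) (hφ : IsTotallySingular φ)
    (ψ : QuadraticForm F W) (hψ : IsTotallySingular ψ) : Prop :=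
  Module.finrank F V = Module.finrank F W ∧
    ∀ (E : Type u) [Field E] [Algebra F E],
      defect (baseChange E φ hφ) = defect (baseChange E ψ hψ)

/-- Weak Vishik equivalence: equal dimensions, and equal defects over `F(√a)` for every `a ∈ F`. -/
def WeaklyVishikEquivalent (φ : QuadraticForm F V) (hφ : IsTotallySingular φ)
    (ψ : QuadraticForm F W) (hψ : IsTotallySingular ψ) : Prop :=
  Module.finrank F V = Module.finrank F W ∧
    ∀ a : F, defect (baseChange (sqrtExtension a) φ hφ) = defect (baseChange (sqrtExtension a) ψ hψ)

variable (F) in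
/-- The subfield `F²` of squares of a field `F` of characteristic `2`. -/
def squares : Subfield F := (frobenius F 2).fieldRange

/-- The norm field `N_F(φ) = F²(a / b : a, b nonzero values of φ)`, as an extension of `F²`. -/
def normField (φ : QuadraticForm F V) : IntermediateField (squares F) F :=
  IntermediateField.adjoin (squares F)
    {x : F | ∃ v w : V, φ v ≠ 0 ∧ φ w ≠ 0 ∧ x = φ v / φ w}

/-- The norm degree `[N_F(φ) : F²]`. -/
noncomputable def normDegree (φ : QuadraticForm F V) : ℕ :=
  Module.finrank (squares F) (normField φ)

/-- `φ` is minimal if it is anisotropic and its norm degree is `2 ^ (dim φ - 1)`. The form of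
dimension `0` is not minimal: its norm degree is `1`, not `2 ^ (-1)`. -/
def IsMinimal (φ : QuadraticForm F V) : Prop :=
  φ.Anisotropic ∧ 0 < Module.finrank F V ∧ normDegree φ = 2 ^ (Module.finrank F V - 1)

end Char2

end TSForm

/-!
A totally singular form is, up to isometry, determined by its dimension and its set of values, which
is a subspace of `F` over the field `F²` of squares (`equivalent_of_valueSpace_eq`). Let `S` and `T`
be the spaces of values of `φ` and `ψ`; the claim becomes `S = c T` for some `c ≠ 0`.

The field `F(√0) = F` shows that `S` and `T` have the same dimension. If `a` is not a square,
`φ_{F(√a)}` regarded over `F` is `φ ⟂ a φ`, so its defect is determined by `dim (S ∩ a S)`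
(`finrank_valueSpace_inf_smul`); hence `dim (S ∩ a S) = dim (T ∩ a T)` for all such `a`. After
scaling, `1 ∈ T`, and then every `t ∈ T` is a product of two elements of `S`, since `T ∩ t T` and
thus `S ∩ t S` is nonzero.

Minimality of `S` means that the ratios of a basis of `S` to one of its members are `2`-independent,
so that their squarefree monomials are linearly independent over `F²`. It follows that, modulo `F²`,
products of two elements of `S` behave like bivectors in `Λ² S`
(`wedgeFactors_of_finrank_adjoin`). So `T` becomes a linear space of decomposable bivectors. By the
Plücker relation the planes of any two of them meet
(`WedgeFactors.exists_mem_span_pair_inf`), and therefore either all have a common factor `u`, or all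
bivectors of some three-dimensional space `⟨u, a, b⟩` occur. In the second case `T ∩ u a T` has
dimension at least three, while `S ∩ u a S` is the plane of `u` and `a`
(`WedgeFactors.false_of_triangle`). In the first case `T ⊆ u S`, with equality by dimensions.
-/

namespace TSForm

open scoped Pointwise

/-! ### Squarefree monomials and products as bivectors -/

section Squares

variable {F : Type u} [Field F] [CharP F 2]

/-- The square of `x`, as an element of the subfield `F²` of squares. -/
def sq (x : F) : squares F := ⟨x ^ 2, x, rfl⟩

@[simp] theorem coe_sq (x : F) : (sq x : F) = x ^ 2 := rfl

theorem sq_smul (x y : F) : sq x • y = x ^ 2 * y := rfl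

theorem mem_squares_iff {x : F} : x ∈ squares F ↔ ∃ y, y ^ 2 = x := Iff.rfl

theorem sq_ne_zero {x : F} (hx : x ≠ 0) : sq x ≠ 0 := fun h =>
  pow_ne_zero 2 hx (congrArg Subtype.val h)

theorem sq_bijective : Function.Bijective (sq : F → squares F) := by
  refine ⟨fun x y h => frobenius_inj F 2 (congrArg Subtype.val h), ?_⟩
  rintro ⟨_, x, rfl⟩
  exact ⟨x, rfl⟩

theorem isAlgebraic_squares (x : F) : IsAlgebraic (squares F) x := by
  have h : IsIntegral (squares F) (x ^ 2) := isIntegral_algebraMap (x := sq x)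
  exact (h.of_pow two_pos).isAlgebraic

/-- A linear map on `E` can be prescribed freely on a linearly independent family. -/
theorem exists_linearMap_apply_eq {K E M ι : Type*} [Field K] [AddCommGroup E] [Module K E]
    [AddCommGroup M] [Module K M] {v : ι → E} (hv : LinearIndependent K v) (w : ι → M) :
    ∃ f : E →ₗ[K] M, ∀ i, f (v i) = w i := by
  obtain ⟨f, hf⟩ := LinearMap.exists_extend ((Module.Basis.span hv).constr K w)
  refine ⟨f, fun i => ?_⟩
  have h := LinearMap.congr_fun hf (Module.Basis.span hv i)
  rw [Module.Basis.constr_basis, LinearMap.comp_apply, Submodule.subtype_apply,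
    Module.Basis.span_apply] at h
  exact h

/-- The squarefree monomials in the `c i` span an algebra over `F²`. If the field generated by the
`c i` has the largest possible degree `2 ^ m`, they are therefore linearly independent. -/
theorem linearIndependent_prod_of_le_adjoin {ι : Type*} [Fintype ι] [DecidableEq ι] (c : ι → F)
    (N : IntermediateField (squares F) F)
    (hN : N ≤ IntermediateField.adjoin (squares F) (Set.range c))
    (hdeg : 2 ^ Fintype.card ι ≤ Module.finrank (squares F) N) :
    LinearIndependent (squares F) (fun I : Finset ι => ∏ i ∈ I, c i) := by
  set P := Submodule.span (squares F) (Set.range fun I : Finset ι => ∏ i ∈ I, c i) with hP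
  have hmul : ∀ i, ∀ x ∈ P, c i * x ∈ P := by
    intro i x hx
    induction hx using Submodule.span_induction with
    | mem x hx =>
      obtain ⟨I, rfl⟩ := hx
      by_cases hi : i ∈ I
      · have : c i * ∏ j ∈ I, c j = sq (c i) • ∏ j ∈ I.erase i, c j := by
          rw [sq_smul, ← Finset.mul_prod_erase I c hi]; ring
        simp only [this]
        exact P.smul_mem _ (Submodule.subset_span ⟨_, rfl⟩)
      · exact Submodule.subset_span ⟨insert i I, Finset.prod_insert hi⟩
    | zero => simp
    | add x y _ _ hx hy => rw [mul_add]; exact P.add_mem hx hy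
    | smul r x _ hx => rw [mul_smul_comm]; exact P.smul_mem _ hx
  have hadj : Subalgebra.toSubmodule (Algebra.adjoin (squares F) (Set.range c)) ≤ P := by
    rw [Algebra.adjoin_eq_span, Submodule.span_le]
    intro x hx
    induction hx using Submonoid.closure_induction_left with
    | one => exact Submodule.subset_span ⟨∅, rfl⟩
    | mul_left y hy x _ hx =>
      obtain ⟨i, rfl⟩ := hy
      exact hmul i x hx
  have hle : Subalgebra.toSubmodule N.toSubalgebra ≤ P := by
    refine le_trans (fun x hx => ?_) hadj
    have hx' : x ∈ (IntermediateField.adjoin (squares F) (Set.range c)).toSubalgebra := hN hx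
    rwa [IntermediateField.adjoin_toSubalgebra_of_isAlgebraic
      (fun x _ => isAlgebraic_squares x)] at hx'
  have : FiniteDimensional (squares F) P :=
    FiniteDimensional.span_of_finite _ (Set.finite_range _)
  rw [linearIndependent_iff_card_le_finrank_span, Fintype.card_finset]
  exact hdeg.trans (Submodule.finrank_mono hle)

/-- The property of a subspace `S` of `F` that all alternating forms `f ∧ g` on `S` factor through
the multiplication `S × S → F`: modulo `F²`, the product `p * q` determines the bivector `p ∧ q`. (In
characteristic `2` the sign in `f ∧ g` is irrelevant.) -/
def WedgeFactors (S : Submodule (squares F) F) : Prop :=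
  ∀ f g : F →ₗ[squares F] squares F, ∃ l : F →ₗ[squares F] squares F,
    ∀ p ∈ S, ∀ q ∈ S, l (p * q) = f p * g q + f q * g p

theorem wedgeFactors_span_of_linearIndependent_prod {m : ℕ} (b : Fin (m + 1) → F) (hb : b 0 ≠ 0)
    (hli : LinearIndependent (squares F)
      (fun I : Finset (Fin m) => ∏ i ∈ I, b i.succ / b 0)) :
    WedgeFactors (Submodule.span (squares F) (Set.range b)) := by
  intro f g
  -- The weight is arbitrary on monomials of degree at least three; this formula has the required
  -- values in degree at most two.
  obtain ⟨l, hl⟩ := exists_linearMap_apply_eq hli (fun I =>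
    if I.card = 1 then f (b 0) * (∑ i ∈ I, g (b i.succ)) + (∑ i ∈ I, f (b i.succ)) * g (b 0)
    else (∑ i ∈ I, f (b i.succ)) * (∑ i ∈ I, g (b i.succ)) + ∑ i ∈ I, f (b i.succ) * g (b i.succ))
  have h1 : l 1 = 0 := by simpa using hl ∅
  have hsq : ∀ x, l (x ^ 2) = 0 := fun x => by
    rw [← mul_one (x ^ 2), ← sq_smul, map_smul, h1, smul_zero]
  have hs : ∀ i, l (b (Fin.succ i) / b 0) = f (b 0) * g (b i.succ) + f (b i.succ) * g (b 0) :=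
    fun i => by simpa using hl {i}
  have hp : ∀ i j : Fin m, i ≠ j → l (b i.succ / b 0 * (b j.succ / b 0))
      = f (b i.succ) * g (b j.succ) + f (b j.succ) * g (b i.succ) := fun i j hij => by
    have h := hl {i, j}
    simp only [Finset.card_pair hij, Finset.prod_pair hij, Finset.sum_pair hij] at h
    rw [h, if_neg (by decide)]
    linear_combination (f (b i.succ) * g (b i.succ) + f (b j.succ) * g (b j.succ)) *
      (CharTwo.two_eq_zero (R := squares F))
  have hij : ∀ i j, l (b i / b 0 * (b j / b 0)) = f (b i) * g (b j) + f (b j) * g (b i) := by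
    intro i j
    by_cases h : i = j
    · rw [h, ← pow_two, hsq, CharTwo.add_self_eq_zero]
    · induction i using Fin.cases with
      | zero =>
        induction j using Fin.cases with
        | zero => exact absurd rfl h
        | succ j => rw [div_self hb, one_mul, hs]
      | succ i =>
        induction j using Fin.cases with
        | zero => rw [div_self hb, mul_one, hs]; ring
        | succ j => exact hp i j (fun h' => h (congrArg _ h'))
  refine ⟨l ∘ₗ LinearMap.mulLeft (squares F) ((b 0)⁻¹ ^ 2), fun p hp q hq => ?_⟩
  simp only [LinearMap.comp_apply, LinearMap.mulLeft_apply]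
  induction hp, hq using Submodule.span_induction₂ with
  | mem_mem x y hx hy =>
    obtain ⟨i, rfl⟩ := hx
    obtain ⟨j, rfl⟩ := hy
    rw [← hij]; congr 1; ring
  | zero_left y _ => simp
  | zero_right x _ => simp
  | add_left x y z _ _ _ h1 h2 => rw [add_mul, mul_add, map_add, h1, h2, map_add, map_add]; ring
  | add_right x y z _ _ _ h1 h2 => rw [mul_add, mul_add, map_add, h1, h2, map_add, map_add]; ring
  | smul_left r x y _ _ h =>
    rw [smul_mul_assoc, mul_smul_comm, map_smul, h, map_smul, map_smul]
    simp only [smul_eq_mul]; ring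
  | smul_right r x y _ _ h =>
    rw [mul_smul_comm, mul_smul_comm, map_smul, h, map_smul, map_smul]
    simp only [smul_eq_mul]; ring

/-- Minimality of a subspace `S` of `F` in terms of the exterior square: if the ratios of elements
of `S` generate a field of degree at least `2 ^ (dim S - 1)` over `F²`, alternating forms on `S`
factor through multiplication. -/
theorem wedgeFactors_of_finrank_adjoin (S : Submodule (squares F) F)
    [FiniteDimensional (squares F) S] (hS : 0 < Module.finrank (squares F) S)
    (hdeg : 2 ^ (Module.finrank (squares F) S - 1) ≤ Module.finrank (squares F)
      (IntermediateField.adjoin (squares F) {x : F | ∃ v ∈ S, ∃ w ∈ S, x = v / w})) :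
    WedgeFactors S := by
  obtain ⟨m, hm⟩ : ∃ m, Module.finrank (squares F) S = m + 1 :=
    ⟨_, (Nat.succ_pred_eq_of_pos hS).symm⟩
  let B := Module.finBasisOfFinrankEq (squares F) S hm
  let b : Fin (m + 1) → F := fun i => B i
  have hb : b 0 ≠ 0 := fun h => B.ne_zero 0 (Subtype.ext h)
  have hspan : Submodule.span (squares F) (Set.range b) = S := by
    have : Set.range b = S.subtype '' Set.range B := by
      rw [← Set.range_comp]; rfl
    rw [this, Submodule.span_image, B.span_eq, Submodule.map_top, Submodule.range_subtype]
  rw [hm, Nat.add_sub_cancel] at hdeg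
  rw [← hspan]
  refine wedgeFactors_span_of_linearIndependent_prod b hb ?_
  refine linearIndependent_prod_of_le_adjoin (fun i : Fin m => b i.succ / b 0) _ ?_
    (by rwa [Fintype.card_fin])
  set A := IntermediateField.adjoin (squares F) (Set.range fun i : Fin m => b i.succ / b 0)
  have hdiv : ∀ v ∈ S, v / b 0 ∈ A := by
    intro v hv
    rw [← hspan] at hv
    induction hv using Submodule.span_induction with
    | mem x hx =>
      obtain ⟨i, rfl⟩ := hx
      induction i using Fin.cases with
      | zero => rw [div_self hb]; exact one_mem A
      | succ i => exact IntermediateField.subset_adjoin _ _ ⟨i, rfl⟩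
    | zero => simp
    | add x y _ _ hx hy => rw [add_div]; exact add_mem hx hy
    | smul r x _ hx => rw [smul_div_assoc]; exact A.smul_mem hx
  refine IntermediateField.adjoin_le_iff.mpr ?_
  rintro _ ⟨v, hv, w, hw, rfl⟩
  have := div_mem (hdiv v hv) (hdiv w hw)
  rwa [div_div_div_cancel_right₀ hb] at this

end Squares

/-! ### Spaces of decomposable bivectors -/

section Subspaces

variable {F : Type u} [Field F] [CharP F 2]

theorem mem_smul_iff {a x : F} {S : Submodule (squares F) F} :
    x ∈ a • S ↔ ∃ s ∈ S, a * s = x :=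
  Submodule.mem_smul_pointwise_iff_exists x a S

theorem finrank_smul {a : F} (ha : a ≠ 0) (S : Submodule (squares F) F) :
    Module.finrank (squares F) (a • S : Submodule (squares F) F) = Module.finrank (squares F) S :=
  (Submodule.equivMapOfInjective (LinearMap.mulLeft (squares F) a)
    (mul_right_injective₀ ha) S).finrank_eq.symm

theorem smul_inf {a : F} (ha : a ≠ 0) (S T : Submodule (squares F) F) :
    a • (S ⊓ T) = a • S ⊓ a • T :=
  Submodule.map_inf (LinearMap.mulLeft (squares F) a) (mul_right_injective₀ ha)

theorem mem_of_mem_squares {T : Submodule (squares F) F} (h1 : (1 : F) ∈ T) {r : F}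
    (hr : r ∈ squares F) : r ∈ T := by
  have h := T.smul_mem (⟨r, hr⟩ : squares F) h1
  rwa [Subfield.smul_def, smul_eq_mul, mul_one] at h

/-- As `1 = x * (x⁻² x)`, every multiple `x S` with `0 ≠ x ∈ S` contains `1`. -/
theorem one_mem_smul_self {S : Submodule (squares F) F} {x : F} (hx : x ∈ S) (hx0 : x ≠ 0) :
    (1 : F) ∈ x • S :=
  mem_smul_iff.mpr ⟨_, S.smul_mem (sq x⁻¹) hx, by rw [sq_smul]; field_simp⟩

theorem mul_mem_of_mem_span_pair {T : Submodule (squares F) F} (h1 : (1 : F) ∈ T) {p q : F}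
    (hpq : p * q ∈ T) {a b : F} (ha : a ∈ Submodule.span (squares F) {p, q})
    (hb : b ∈ Submodule.span (squares F) {p, q}) : a * b ∈ T := by
  have hsq : ∀ x : F, x * x ∈ T := fun x =>
    mem_of_mem_squares h1 (mem_squares_iff.mpr ⟨x, pow_two x⟩)
  induction ha, hb using Submodule.span_induction₂ with
  | mem_mem x y hx hy =>
    rcases hx with rfl | rfl <;> rcases hy with rfl | rfl
    · exact hsq _
    · exact hpq
    · rwa [mul_comm]
    · exact hsq _
  | zero_left y _ => simp
  | zero_right x _ => simp
  | add_left x y z _ _ _ h1 h2 => rw [add_mul]; exact T.add_mem h1 h2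
  | add_right x y z _ _ _ h1 h2 => rw [mul_add]; exact T.add_mem h1 h2
  | smul_left r x y _ _ h => rw [smul_mul_assoc]; exact T.smul_mem _ h
  | smul_right r x y _ _ h => rw [mul_smul_comm]; exact T.smul_mem _ h

/-- Modulo `F²`, the product `x * y` is the bivector `x ∧ y`, which vanishes just for dependent
vectors. -/
theorem linearIndependent_pair_iff_mul_notMem_squares {x y : F} :
    LinearIndependent (squares F) ![x, y] ↔ x * y ∉ squares F := by
  rw [LinearIndependent.pair_iff]
  constructor
  · intro h hxy
    by_cases hx : x = 0
    · exact one_ne_zero (h 1 0 (by simp [hx])).1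
    · refine sq_ne_zero hx (h (⟨x * y, hxy⟩ : squares F) (sq x) ?_).2
      rw [sq_smul, Subfield.smul_def, smul_eq_mul]
      linear_combination x ^ 2 * y * CharTwo.two_eq_zero (R := F)
  · intro h s t hst
    have hk : ∀ r : squares F, (r : F) ∈ squares F := fun r => r.2
    have hsq : ∀ z : F, z ^ 2 ∈ squares F := fun z => ⟨z, rfl⟩
    simp only [Subfield.smul_def, smul_eq_mul] at hst
    have hs : (s : F) = 0 := by
      by_contra hs
      apply h
      have : x * y = -(t / s * y ^ 2) := by field_simp; linear_combination y * hst
      rw [this]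
      exact neg_mem (mul_mem (div_mem (hk t) (hk s)) (hsq y))
    have ht : (t : F) = 0 := by
      by_contra ht
      apply h
      have : x * y = -(s / t * x ^ 2) := by field_simp; linear_combination x * hst
      rw [this]
      exact neg_mem (mul_mem (div_mem (hk s) (hk t)) (hsq x))
    exact ⟨Subtype.ext hs, Subtype.ext ht⟩

theorem linearIndependent_triple_iff {x y z : F} :
    LinearIndependent (squares F) ![z, x, y] ↔
      LinearIndependent (squares F) ![x, y] ∧ z ∉ Submodule.span (squares F) {x, y} := by
  rw [← Matrix.range_cons_cons_empty x y ![]]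
  exact linearIndependent_finCons

/-- A product `z * w` is, for any nonzero `v` in the plane of `z` and `w`, also a product with
factor `v`. -/
theorem exists_mul_eq_mul_of_mem_span_pair {z w v : F} (hv : v ≠ 0)
    (h : v ∈ Submodule.span (squares F) {z, w}) :
    ∃ w' ∈ Submodule.span (squares F) {z, w}, z * w = v * w' := by
  have hz : z ∈ Submodule.span (squares F) {z, w} := Submodule.subset_span (by simp)
  have hw : w ∈ Submodule.span (squares F) {z, w} := Submodule.subset_span (by simp)
  obtain ⟨α, β, hαβ⟩ := Submodule.mem_span_pair.mp h
  by_cases hα : α = 0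
  · have hβ : (β : F) ≠ 0 := fun hβ =>
      hv (by rw [← hαβ, hα, Subtype.ext (a2 := (0 : squares F)) hβ, zero_smul, zero_smul, add_zero])
    refine ⟨β⁻¹ • z, Submodule.smul_mem _ _ hz, ?_⟩
    simp only [← hαβ, hα, Subfield.smul_def, smul_eq_mul, Subfield.coe_inv, Subfield.coe_zero]
    field_simp
    ring
  · have hα' : (α : F) ≠ 0 := fun h' => hα (Subtype.ext h')
    refine ⟨α⁻¹ • w + (-β * α⁻¹ * sq w * (sq v)⁻¹) • v,
      Submodule.add_mem _ (Submodule.smul_mem _ _ hw) (Submodule.smul_mem _ _ h), ?_⟩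
    simp only [Subfield.smul_def, smul_eq_mul, Subfield.coe_inv, Subfield.coe_mul,
      Subfield.coe_neg, coe_sq] at hαβ ⊢
    field_simp
    linear_combination w * hαβ

namespace WedgeFactors

variable {S : Submodule (squares F) F}

/-- The bivectors `v ∧ w` and `u ∧ s` differ if `u, v, w` are independent. -/
theorem mul_ne_mul (hS : WedgeFactors S) {u v w s : F} (hu : u ∈ S) (hv : v ∈ S) (hw : w ∈ S)
    (hs : s ∈ S) (hli : LinearIndependent (squares F) ![w, u, v]) : v * w ≠ u * s := by
  intro h
  obtain ⟨f, hf⟩ := exists_linearMap_apply_eq hli ![(0 : squares F), 0, 1]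
  obtain ⟨g, hg⟩ := exists_linearMap_apply_eq hli ![(1 : squares F), 0, 0]
  obtain ⟨l, hl⟩ := hS f g
  have h1 := hl v hv w hw
  rw [h, hl u hu s hs] at h1
  have f0 : f w = 0 := hf 0
  have f1 : f u = 0 := hf 1
  have f2 : f v = 1 := hf 2
  have g0 : g w = 1 := hg 0
  have g1 : g u = 0 := hg 1
  have g2 : g v = 0 := hg 2
  simp [f0, f1, f2, g0, g1] at h1

/-- If the sum of two decomposable bivectors `x ∧ y` and `z ∧ w` is again decomposable, the planes
of the two bivectors meet: otherwise the Plücker relation for `p ∧ q` would fail. -/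
theorem exists_mem_span_pair_inf (hS : WedgeFactors S) {x y z w p q : F} (hx : x ∈ S) (hy : y ∈ S)
    (hz : z ∈ S) (hw : w ∈ S) (hp : p ∈ S) (hq : q ∈ S) (hxy : x * y ∉ squares F)
    (hzw : z * w ∉ squares F) (h : x * y + z * w = p * q) :
    ∃ v, v ≠ 0 ∧ v ∈ Submodule.span (squares F) {x, y} ∧ v ∈ Submodule.span (squares F) {z, w} := by
  by_contra! hno
  have hli : LinearIndependent (squares F) (Sum.elim ![x, y] ![z, w]) := by
    refine LinearIndependent.sum_type (linearIndependent_pair_iff_mul_notMem_squares.mpr hxy)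
      (linearIndependent_pair_iff_mul_notMem_squares.mpr hzw) ?_
    rw [Submodule.disjoint_def, Matrix.range_cons_cons_empty, Matrix.range_cons_cons_empty]
    intro v hv hv'
    by_contra h0
    exact hno v h0 hv hv'
  obtain ⟨f₁, hf₁⟩ := exists_linearMap_apply_eq hli (Sum.elim ![(1 : squares F), 0] ![0, 0])
  obtain ⟨f₂, hf₂⟩ := exists_linearMap_apply_eq hli (Sum.elim ![(0 : squares F), 1] ![0, 0])
  obtain ⟨f₃, hf₃⟩ := exists_linearMap_apply_eq hli (Sum.elim ![(0 : squares F), 0] ![1, 0])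
  obtain ⟨f₄, hf₄⟩ := exists_linearMap_apply_eq hli (Sum.elim ![(0 : squares F), 0] ![0, 1])
  have key : ∀ f g : F →ₗ[squares F] squares F,
      (f x * g y + f y * g x) + (f z * g w + f w * g z) = f p * g q + f q * g p := by
    intro f g
    obtain ⟨l, hl⟩ := hS f g
    rw [← hl x hx y hy, ← hl z hz w hw, ← hl p hp q hq, ← h, map_add]
  have a1 : f₁ x = 1 := hf₁ (.inl 0)
  have a2 : f₁ y = 0 := hf₁ (.inl 1)
  have a3 : f₁ z = 0 := hf₁ (.inr 0)
  have a4 : f₁ w = 0 := hf₁ (.inr 1)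
  have b1 : f₂ x = 0 := hf₂ (.inl 0)
  have b2 : f₂ y = 1 := hf₂ (.inl 1)
  have b3 : f₂ z = 0 := hf₂ (.inr 0)
  have b4 : f₂ w = 0 := hf₂ (.inr 1)
  have c1 : f₃ x = 0 := hf₃ (.inl 0)
  have c2 : f₃ y = 0 := hf₃ (.inl 1)
  have c3 : f₃ z = 1 := hf₃ (.inr 0)
  have c4 : f₃ w = 0 := hf₃ (.inr 1)
  have d1 : f₄ x = 0 := hf₄ (.inl 0)
  have d2 : f₄ y = 0 := hf₄ (.inl 1)
  have d3 : f₄ z = 0 := hf₄ (.inr 0)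
  have d4 : f₄ w = 1 := hf₄ (.inr 1)
  have k12 := key f₁ f₂
  have k34 := key f₃ f₄
  have k13 := key f₁ f₃
  have k24 := key f₂ f₄
  have k14 := key f₁ f₄
  have k23 := key f₂ f₃
  simp only [a1, a2, a3, a4, b1, b2, b3, b4, c1, c2, c3, c4, d1, d2, d3, d4, mul_zero, mul_one,
    add_zero, zero_add] at k12 k34 k13 k24 k14 k23
  have two : (2 : squares F) = 0 := CharTwo.two_eq_zero
  -- The Plücker relation `π₁₂ π₃₄ + π₁₃ π₂₄ + π₁₄ π₂₃ = 0` for the coordinates of `p ∧ q`.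
  have pl : (f₁ p * f₂ q + f₁ q * f₂ p) * (f₃ p * f₄ q + f₃ q * f₄ p)
      + (f₁ p * f₃ q + f₁ q * f₃ p) * (f₂ p * f₄ q + f₂ q * f₄ p)
      + (f₁ p * f₄ q + f₁ q * f₄ p) * (f₂ p * f₃ q + f₂ q * f₃ p) = 0 := by
    linear_combination (f₁ p * f₂ p * f₃ q * f₄ q + f₁ p * f₂ q * f₃ p * f₄ q
      + f₁ p * f₂ q * f₃ q * f₄ p + f₁ q * f₂ p * f₃ p * f₄ q
      + f₁ q * f₂ p * f₃ q * f₄ p + f₁ q * f₂ q * f₃ p * f₄ p) * two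
  rw [← k12, ← k34, ← k13, ← k14] at pl
  simp at pl

/-- A space `T` cannot contain the bivectors of a whole three-dimensional space `⟨u, a, b⟩`: with
`A = u a`, the space `T ∩ A T` contains `1, u a, a b`, whereas `S ∩ A S` is the plane of `u` and
`a`. -/
theorem false_of_triangle (hS : WedgeFactors S) {T : Submodule (squares F) F}
    [FiniteDimensional (squares F) T]
    (hfin : ∀ a : F, a ∉ squares F → Module.finrank (squares F) (S ⊓ a • S : Submodule _ F)
      = Module.finrank (squares F) (T ⊓ a • T : Submodule _ F))
    (h1 : (1 : F) ∈ T) {u a b : F} (hu : u ∈ S) (ha : a ∈ S) (hb : b ∈ S)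
    (hli : LinearIndependent (squares F) ![b, u, a])
    (hua : u * a ∈ T) (hub : u * b ∈ T) (hab : a * b ∈ T) : False := by
  obtain ⟨hli2, hb'⟩ := linearIndependent_triple_iff.mp hli
  have hA := linearIndependent_pair_iff_mul_notMem_squares.mp hli2
  have hu0 : u ≠ 0 := fun h => hA (by rw [h, zero_mul]; exact zero_mem _)
  have ha0 : a ≠ 0 := fun h => hA (by rw [h, mul_zero]; exact zero_mem _)
  have hle : (S ⊓ (u * a) • S : Submodule _ F) ≤ Submodule.span (squares F) {u, a} := by
    rintro s ⟨hs, hs'⟩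
    obtain ⟨s', hsS, rfl⟩ := mem_smul_iff.mp hs'
    by_cases hmem : s' ∈ Submodule.span (squares F) {u, a}
    · obtain ⟨α, β, rfl⟩ := Submodule.mem_span_pair.mp hmem
      refine Submodule.mem_span_pair.mpr ⟨β * sq a, α * sq u, ?_⟩
      simp only [Subfield.smul_def, smul_eq_mul, Subfield.coe_mul, coe_sq]
      ring
    · refine absurd ?_ (hS.mul_ne_mul hu ha hsS (S.smul_mem (sq u⁻¹) hs)
        (linearIndependent_triple_iff.mpr ⟨hli2, hmem⟩))
      rw [sq_smul]
      field_simp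
  have hle2 : Module.finrank (squares F) (S ⊓ (u * a) • S : Submodule _ F) ≤ 2 := by
    have h2 := finrank_range_le_card (R := squares F) ![u, a]
    rw [Set.finrank, Matrix.range_cons_cons_empty, Fintype.card_fin] at h2
    have : FiniteDimensional (squares F) (Submodule.span (squares F) {u, a}) :=
      FiniteDimensional.span_of_finite _ (Set.toFinite _)
    exact (Submodule.finrank_mono hle).trans h2
  have hli3 : LinearIndependent (squares F) ![a * b, 1, u * a] := by
    refine linearIndependent_triple_iff.mpr
      ⟨linearIndependent_pair_iff_mul_notMem_squares.mpr (by rwa [one_mul]), fun h => ?_⟩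
    obtain ⟨α, β, h⟩ := Submodule.mem_span_pair.mp h
    refine hS.mul_ne_mul hu ha hb (S.add_mem (S.smul_mem (α * sq u⁻¹) hu) (S.smul_mem β ha)) hli ?_
    rw [← h]
    simp only [Subfield.smul_def, smul_eq_mul, Subfield.coe_mul, coe_sq]
    field_simp
  have hge : Submodule.span (squares F) (Set.range ![a * b, 1, u * a])
      ≤ (T ⊓ (u * a) • T : Submodule _ F) := by
    rw [Submodule.span_le]
    rintro _ ⟨i, rfl⟩
    fin_cases i
    · exact ⟨hab, mem_smul_iff.mpr ⟨_, T.smul_mem (sq u⁻¹) hub, by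
        simp only [sq_smul]; field_simp; rfl⟩⟩
    · exact ⟨h1, one_mem_smul_self hua (mul_ne_zero hu0 ha0)⟩
    · exact ⟨hua, mem_smul_iff.mpr ⟨1, h1, mul_one _⟩⟩
  have h3 := finrank_span_eq_card hli3
  have h4 := Submodule.finrank_mono hge
  rw [← hfin _ hA, h3, Fintype.card_fin] at h4
  omega

/-- A linear space of products of elements of `S` that contains `1` lies in some `u S`, as a linear
space of decomposable bivectors either has a common factor `u` or consists of bivectors of a
three-dimensional space; the second case is excluded by `false_of_triangle`. -/
theorem exists_le_smul (hS : WedgeFactors S) {T : Submodule (squares F) F}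
    [FiniteDimensional (squares F) T] (hS0 : ∃ s ∈ S, s ≠ 0)
    (hfin : ∀ a : F, a ∉ squares F → Module.finrank (squares F) (S ⊓ a • S : Submodule _ F)
      = Module.finrank (squares F) (T ⊓ a • T : Submodule _ F))
    (h1 : (1 : F) ∈ T) (hT : ∀ t ∈ T, ∃ p ∈ S, ∃ q ∈ S, t = p * q) :
    ∃ u ∈ S, u ≠ 0 ∧ T ≤ u • S := by
  have span_le : ∀ {p q}, p ∈ S → q ∈ S → Submodule.span (squares F) {p, q} ≤ S :=
    fun hp hq => Submodule.span_le.mpr (by rintro _ (rfl | rfl) <;> assumption)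
  have left_mem : ∀ p q : F, p ∈ Submodule.span (squares F) {p, q} :=
    fun p q => Submodule.subset_span (by simp)
  have meet : ∀ {x y z w}, x ∈ S → y ∈ S → z ∈ S → w ∈ S → x * y ∈ T → z * w ∈ T →
      x * y ∉ squares F → z * w ∉ squares F → ∃ v, v ≠ 0 ∧
        v ∈ Submodule.span (squares F) {x, y} ∧ v ∈ Submodule.span (squares F) {z, w} := by
    intro x y z w hx hy hz hw h h' hk hk'
    obtain ⟨p, hp, q, hq, hpq⟩ := hT _ (T.add_mem h h')
    exact hS.exists_mem_span_pair_inf hx hy hz hw hp hq hk hk' hpq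
  by_contra! hno
  have hnk : ∀ {u t}, u ∈ S → u ≠ 0 → t ∉ u • S → t ∉ squares F := fun hu hu0 ht hk =>
    ht (mem_of_mem_squares (one_mem_smul_self hu hu0) hk)
  obtain ⟨s, hs, hs0⟩ := hS0
  obtain ⟨t₁, ht₁, ht₁s⟩ := SetLike.not_le_iff_exists.mp (hno s hs hs0)
  have hk₁ := hnk hs hs0 ht₁s
  obtain ⟨x, hx, y, hy, rfl⟩ := hT t₁ ht₁
  have hx0 : x ≠ 0 := fun h => hk₁ (by rw [h, zero_mul]; exact zero_mem _)
  obtain ⟨t₂, ht₂, ht₂x⟩ := SetLike.not_le_iff_exists.mp (hno x hx hx0)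
  have hk₂ := hnk hx hx0 ht₂x
  obtain ⟨z, hz, w, hw, rfl⟩ := hT t₂ ht₂
  obtain ⟨u, hu0, huxy, huzw⟩ := meet hx hy hz hw ht₁ ht₂ hk₁ hk₂
  have hu : u ∈ S := span_le hx hy huxy
  -- A common vector `u` of the two planes gives `x y = u x'` and `z w = u w'`.
  obtain ⟨x', hx', hux'⟩ := exists_mul_eq_mul_of_mem_span_pair hu0 huxy
  obtain ⟨w', hw', huw'⟩ := exists_mul_eq_mul_of_mem_span_pair hu0 huzw
  have hw'n : w' ∉ Submodule.span (squares F) {u, x'} := by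
    intro h
    have hle : Submodule.span (squares F) {u, x'} ≤ Submodule.span (squares F) {x, y} :=
      Submodule.span_le.mpr (by rintro _ (rfl | rfl) <;> assumption)
    refine ht₂x ?_
    rw [huw']
    exact mul_mem_of_mem_span_pair (one_mem_smul_self hx hx0) (mem_smul_iff.mpr ⟨y, hy, rfl⟩)
      huxy (hle h)
  rw [hux'] at ht₁ hk₁
  rw [huw'] at ht₂ hk₂
  have hx'S := span_le hx hy hx'
  have hw'S := span_le hz hw hw'
  obtain ⟨t₃, ht₃, ht₃u⟩ := SetLike.not_le_iff_exists.mp (hno u hu hu0)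
  have hk₃ := hnk hu hu0 ht₃u
  obtain ⟨p, hp, q, hq, rfl⟩ := hT t₃ ht₃
  have hnu : ∀ v, v ≠ 0 → v ∈ Submodule.span (squares F) {p, q} → ∀ α : squares F, v ≠ α • u := by
    rintro v hv0 hv α rfl
    obtain ⟨q', hq', h⟩ := exists_mul_eq_mul_of_mem_span_pair hv0 hv
    exact ht₃u (mem_smul_iff.mpr ⟨α • q', S.smul_mem _ (span_le hp hq hq'), by
      rw [h, mul_smul_comm, smul_mul_assoc]⟩)
  obtain ⟨a, ha0, ha, hapq⟩ := meet hu hx'S hp hq ht₁ ht₃ hk₁ hk₃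
  obtain ⟨b, hb0, hb, hbpq⟩ := meet hu hw'S hp hq ht₂ ht₃ hk₂ hk₃
  refine hS.false_of_triangle hfin h1 hu (span_le hu hx'S ha) (span_le hu hw'S hb)
    (linearIndependent_triple_iff.mpr ⟨?_, ?_⟩)
    (mul_mem_of_mem_span_pair h1 ht₁ (left_mem _ _) ha)
    (mul_mem_of_mem_span_pair h1 ht₂ (left_mem _ _) hb)
    (mul_mem_of_mem_span_pair h1 ht₃ hapq hbpq)
  · rw [LinearIndependent.pair_iff' hu0]
    exact fun α h => hnu a ha0 hapq α h.symm
  · intro hbua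
    have hle : Submodule.span (squares F) {u, a} ≤ Submodule.span (squares F) {u, x'} :=
      Submodule.span_le.mpr (by rintro _ (rfl | rfl); exacts [left_mem _ _, ha])
    have hb' := hle hbua
    obtain ⟨γ, δ, rfl⟩ := Submodule.mem_span_pair.mp hb
    have hδ : δ ≠ 0 := fun h => hnu _ hb0 hbpq γ (by rw [h, zero_smul, add_zero])
    rw [Submodule.add_mem_iff_right _ (Submodule.smul_mem _ _ (left_mem _ _))] at hb'
    exact hw'n ((Submodule.smul_mem_iff _ hδ).mp hb')

/-- Subspaces `S` and `T` of equal dimension that overlap equally with all their multiples are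
proportional, if `S` is minimal. -/
theorem eq_smul (hS : WedgeFactors S) {T : Submodule (squares F) F}
    [FiniteDimensional (squares F) S] [FiniteDimensional (squares F) T]
    (hS0 : 0 < Module.finrank (squares F) S)
    (hST : Module.finrank (squares F) S = Module.finrank (squares F) T)
    (hfin : ∀ a : F, a ∉ squares F → Module.finrank (squares F) (S ⊓ a • S : Submodule _ F)
      = Module.finrank (squares F) (T ⊓ a • T : Submodule _ F)) :
    ∃ c : F, c ≠ 0 ∧ S = c • T := by
  obtain ⟨s, hs, hs0⟩ := S.ne_bot_iff.mp (Submodule.one_le_finrank_iff.mp hS0)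
  obtain ⟨t, ht, ht0⟩ := T.ne_bot_iff.mp (Submodule.one_le_finrank_iff.mp (hST ▸ hS0))
  have : FiniteDimensional (squares F) (t⁻¹ • T : Submodule (squares F) F) :=
    Module.Finite.map T (LinearMap.mulLeft (squares F) t⁻¹)
  obtain ⟨u, hu, hu0, hle⟩ := hS.exists_le_smul (T := t⁻¹ • T) ⟨s, hs, hs0⟩ (fun a ha => by
      rw [hfin a ha, smul_comm a t⁻¹ T, ← smul_inf (inv_ne_zero ht0),
        finrank_smul (inv_ne_zero ht0)])
    (mem_smul_iff.mpr ⟨t, ht, inv_mul_cancel₀ ht0⟩) (by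
      intro a ha
      by_cases hk : a ∈ squares F
      · exact ⟨_, S.smul_mem (⟨a, hk⟩ * sq s⁻¹) hs, s, hs, by
          simp only [Subfield.smul_def, smul_eq_mul, Subfield.coe_mul, coe_sq]; field_simp⟩
      -- Here `a * t` is a nonzero element of `T ∩ a T`, so `S ∩ a S` is nonzero as well.
      · obtain ⟨r, hr, rfl⟩ := mem_smul_iff.mp ha
        have hr0 : t⁻¹ * r ≠ 0 := fun h => hk (by rw [h]; exact zero_mem _)
        have hne : (T ⊓ (t⁻¹ * r) • T : Submodule _ F) ≠ ⊥ := by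
          refine (Submodule.ne_bot_iff _).mpr ⟨r, ⟨hr, mem_smul_iff.mpr ⟨t, ht, ?_⟩⟩, ?_⟩
          · field_simp
          · rintro rfl; exact hr0 (mul_zero _)
        have h := Submodule.one_le_finrank_iff.mpr hne
        rw [← hfin _ hk] at h
        obtain ⟨p, ⟨hp, hp'⟩, hp0⟩ :=
          (Submodule.ne_bot_iff _).mp (Submodule.one_le_finrank_iff.mp h)
        obtain ⟨q, hq, rfl⟩ := mem_smul_iff.mp hp'
        have hq0 : q ≠ 0 := right_ne_zero_of_mul hp0
        refine ⟨_, hp, _, S.smul_mem (sq q⁻¹) hq, ?_⟩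
        rw [sq_smul]; field_simp)
  have : FiniteDimensional (squares F) (u • S : Submodule (squares F) F) :=
    Module.Finite.map S (LinearMap.mulLeft (squares F) u)
  have heq := Submodule.eq_of_le_of_finrank_eq hle
    (by rw [finrank_smul hu0, finrank_smul (inv_ne_zero ht0), hST])
  refine ⟨u⁻¹ * t⁻¹, mul_ne_zero (inv_ne_zero hu0) (inv_ne_zero ht0), ?_⟩
  rw [mul_smul, heq, ← mul_smul, inv_mul_cancel₀ hu0, one_smul]

end WedgeFactors

end Subspaces

/-! ### Totally singular forms over arbitrary fields -/

section Preliminaries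

variable {F : Type u} [Field F] {V : Type v} [AddCommGroup V] [Module F V]
  {W : Type w} [AddCommGroup W] [Module F W]

theorem IsTotallySingular.anisotropicPart {φ : QuadraticForm F V} (hφ : IsTotallySingular φ) :
    IsTotallySingular (anisotropicPart φ) := by
  intro x y
  induction x using Submodule.Quotient.induction_on with | H v =>
  induction y using Submodule.Quotient.induction_on with | H w =>
  exact hφ v w

theorem IsTotallySingular.smul {φ : QuadraticForm F V} (hφ : IsTotallySingular φ) (c : F) :
    IsTotallySingular (c • φ) := fun v w => by
  rw [FunLike.coe_smul, QuadraticMap.polar_smul, hφ, smul_zero]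

theorem IsTotallySingular.prod {φ : QuadraticForm F V} (hφ : IsTotallySingular φ)
    {ψ : QuadraticForm F W} (hψ : IsTotallySingular ψ) : IsTotallySingular (φ.prod ψ) :=
  fun v w => by rw [QuadraticMap.polar_prod, hφ, hψ, add_zero]

theorem sqrtExtension_zero : sqrtExtension (0 : F) = ⊥ := by
  rw [sqrtExtension, IntermediateField.adjoin_eq_bot_iff]
  intro x hx
  have : x = 0 := by simpa using hx
  rw [this]
  exact zero_mem _

/-- If a form `P` over an extension `E` of `F`, seen over `F`, is isometric to a form `Q` with
values in `F`, its defect can be computed from `Q`. -/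
theorem finrank_mul_defect {E : Type*} [Field E] [Algebra F E] {X : Type*} [AddCommGroup X]
    [Module E X] [Module F X] [IsScalarTower F E X] {P : QuadraticForm E X}
    (hP : IsTotallySingular P) {Q : QuadraticForm F W} (hQ : IsTotallySingular Q)
    (g : W ≃ₗ[F] X) (hg : ∀ x, P (g x) = algebraMap F E (Q x)) :
    Module.finrank F E * defect P = defect Q := by
  rw [defect, Module.finrank_mul_finrank F E P.radical]
  have : Q.radical.map g.toLinearMap = P.radical.restrictScalars F := by
    ext x
    obtain ⟨y, rfl⟩ := g.surjective x
    rw [Submodule.restrictScalars_mem, hP.mem_radical_iff, hg, map_eq_zero, ← hQ.mem_radical_iff]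
    simp
  rw [defect, ← LinearEquiv.finrank_map_eq g, this]
  rfl

end Preliminaries

/-! ### The space of values of a totally singular form -/

section Values

variable {F : Type u} [Field F] [CharP F 2] {V : Type v} [AddCommGroup V] [Module F V]
  {W : Type w} [AddCommGroup W] [Module F W]

/-- The set of values of a totally singular form, as an `F²`-subspace of `F`. -/
def valueSpace (φ : QuadraticForm F V) (hφ : IsTotallySingular φ) : Submodule (squares F) F where
  carrier := Set.range φ
  add_mem' := by
    rintro _ _ ⟨v, rfl⟩ ⟨w, rfl⟩
    exact ⟨v + w, hφ.map_add v w⟩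
  zero_mem' := ⟨0, QuadraticMap.map_zero φ⟩
  smul_mem' := by
    rintro r _ ⟨v, rfl⟩
    obtain ⟨s, rfl⟩ := sq_bijective.2 r
    exact ⟨s • v, by rw [QuadraticMap.map_smul, sq_smul, smul_eq_mul, pow_two]⟩

theorem mem_valueSpace {φ : QuadraticForm F V} {hφ : IsTotallySingular φ} {x : F} :
    x ∈ valueSpace φ hφ ↔ ∃ v, φ v = x := Iff.rfl

theorem valueSpace_anisotropicPart {φ : QuadraticForm F V} (hφ : IsTotallySingular φ) :
    valueSpace (anisotropicPart φ) hφ.anisotropicPart = valueSpace φ hφ := by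
  ext x
  exact ⟨fun ⟨v, hv⟩ => by
    induction v using Submodule.Quotient.induction_on with | H v => exact ⟨v, hv⟩,
    fun ⟨v, hv⟩ => ⟨Submodule.Quotient.mk v, hv⟩⟩

theorem valueSpace_smul {φ : QuadraticForm F V} (hφ : IsTotallySingular φ) (c : F) :
    valueSpace (c • φ) (hφ.smul c) = c • valueSpace φ hφ := by
  ext x
  rw [mem_smul_iff]
  exact ⟨fun ⟨v, hv⟩ => ⟨_, ⟨v, rfl⟩, hv⟩, by rintro ⟨_, ⟨v, rfl⟩, hv⟩; exact ⟨v, hv⟩⟩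

theorem valueSpace_prod {φ : QuadraticForm F V} (hφ : IsTotallySingular φ)
    {ψ : QuadraticForm F W} (hψ : IsTotallySingular ψ) :
    valueSpace (φ.prod ψ) (hφ.prod hψ) = valueSpace φ hφ ⊔ valueSpace ψ hψ := by
  ext x
  rw [Submodule.mem_sup]
  constructor
  · rintro ⟨⟨v, w⟩, h⟩
    exact ⟨_, ⟨v, rfl⟩, _, ⟨w, rfl⟩, h⟩
  · rintro ⟨_, ⟨v, rfl⟩, _, ⟨w, rfl⟩, h⟩
    exact ⟨(v, w), h⟩

/-- An anisotropic totally singular form is injective, being additive. -/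
theorem IsTotallySingular.injective {φ : QuadraticForm F V} (hφ : IsTotallySingular φ)
    (h : φ.Anisotropic) : Function.Injective φ := by
  intro v w hvw
  rw [← sub_eq_zero]
  apply h
  rw [sub_eq_add_neg, hφ.map_add, QuadraticMap.map_neg, hvw, CharTwo.add_self_eq_zero]

variable (F) in
/-- The Frobenius endomorphism, as a homomorphism onto the subfield of squares. -/
def sqHom : F →+* squares F := (frobenius F 2).rangeRestrictField

theorem sqHom_bijective : Function.Bijective (sqHom F) :=
  (frobenius F 2).rangeRestrictField_bijective

/-- A totally singular form as a Frobenius-semilinear map onto its space of values. -/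
def toValueSpace (φ : QuadraticForm F V) (hφ : IsTotallySingular φ) :
    V →ₛₗ[sqHom F] valueSpace φ hφ where
  toFun v := ⟨φ v, v, rfl⟩
  map_add' v w := Subtype.ext (hφ.map_add v w)
  map_smul' r v := Subtype.ext <| by
    change φ (r • v) = r ^ 2 * φ v
    rw [QuadraticMap.map_smul, smul_eq_mul, pow_two]

theorem toValueSpace_surjective (φ : QuadraticForm F V) (hφ : IsTotallySingular φ) :
    Function.Surjective (toValueSpace φ hφ) := by
  rintro ⟨_, v, rfl⟩
  exact ⟨v, rfl⟩

instance finiteDimensional_valueSpace [FiniteDimensional F V] (φ : QuadraticForm F V)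
    (hφ : IsTotallySingular φ) : FiniteDimensional (squares F) (valueSpace φ hφ) :=
  have : RingHomSurjective (sqHom F) := ⟨sqHom_bijective.2⟩
  Module.Finite.of_surjective (toValueSpace φ hφ) (toValueSpace_surjective φ hφ)

theorem finrank_valueSpace_of_anisotropic {φ : QuadraticForm F V} (hφ : IsTotallySingular φ)
    (h : φ.Anisotropic) : Module.finrank (squares F) (valueSpace φ hφ) = Module.finrank F V := by
  let j : V ≃+ valueSpace φ hφ := AddEquiv.ofBijective (toValueSpace φ hφ).toAddMonoidHom
    ⟨fun v w hvw => hφ.injective h (congrArg Subtype.val hvw), toValueSpace_surjective φ hφ⟩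
  have := lift_rank_eq_of_equiv_equiv (sqHom F) j sqHom_bijective (toValueSpace φ hφ).map_smulₛₗ
  have := congrArg Cardinal.toNat this
  rw [Cardinal.toNat_lift, Cardinal.toNat_lift] at this
  exact this.symm

/-- The space of values is a model of the anisotropic part. -/
theorem finrank_valueSpace_add_defect [FiniteDimensional F V] (φ : QuadraticForm F V)
    (hφ : IsTotallySingular φ) :
    Module.finrank (squares F) (valueSpace φ hφ) + defect φ = Module.finrank F V := by
  rw [← valueSpace_anisotropicPart hφ, finrank_valueSpace_of_anisotropic hφ.anisotropicPart
    (anisotropicPart_anisotropic hφ)]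
  exact Submodule.finrank_quotient_add_finrank _

theorem equivalent_of_anisotropic_of_valueSpace_eq {φ : QuadraticForm F V}
    {hφ : IsTotallySingular φ} {ψ : QuadraticForm F W} {hψ : IsTotallySingular ψ}
    (ha : φ.Anisotropic) (hb : ψ.Anisotropic) (h : valueSpace φ hφ = valueSpace ψ hψ) :
    QuadraticMap.Equivalent φ ψ := by
  have hex : ∀ v, ∃ w, ψ w = φ v := fun v =>
    mem_valueSpace.mp (h ▸ (mem_valueSpace.mpr ⟨v, rfl⟩ : φ v ∈ valueSpace φ hφ))
  choose f hf using hex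
  have hi := hψ.injective hb
  let l : V →ₗ[F] W :=
    { toFun := f
      map_add' := fun v w => hi (by rw [hψ.map_add, hf, hf, hf, hφ.map_add])
      map_smul' := fun r v => hi (by
        rw [hf, QuadraticMap.map_smul, RingHom.id_apply, QuadraticMap.map_smul, hf]) }
  refine ⟨⟨LinearEquiv.ofBijective l ⟨fun v w hvw => hφ.injective ha ?_, fun w => ?_⟩, hf⟩⟩
  · rw [← hf, ← hf]
    exact congrArg ψ hvw
  · obtain ⟨v, hv⟩ := mem_valueSpace.mp
      (h ▸ (mem_valueSpace.mpr ⟨w, rfl⟩ : ψ w ∈ valueSpace ψ hψ))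
    exact ⟨v, hi ((hf v).trans hv)⟩

/-- Totally singular forms are classified by their dimension and their space of values. -/
theorem equivalent_of_valueSpace_eq [FiniteDimensional F V] [FiniteDimensional F W]
    {φ : QuadraticForm F V} {hφ : IsTotallySingular φ} {ψ : QuadraticForm F W}
    {hψ : IsTotallySingular ψ} (hdim : Module.finrank F V = Module.finrank F W)
    (h : valueSpace φ hφ = valueSpace ψ hψ) : QuadraticMap.Equivalent φ ψ := by
  have hd : defect φ = defect ψ := by
    have h1 := finrank_valueSpace_add_defect φ hφ
    have h2 := finrank_valueSpace_add_defect ψ hψ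
    rw [h] at h1
    omega
  have hφ' := equivalent_anisotropicPart_prod φ
  rw [hd] at hφ'
  have hs := equivalent_of_anisotropic_of_valueSpace_eq (anisotropicPart_anisotropic hφ)
    (anisotropicPart_anisotropic hψ) (hφ := hφ.anisotropicPart) (hψ := hψ.anisotropicPart)
    (by rw [valueSpace_anisotropicPart hφ, valueSpace_anisotropicPart hψ, h])
  exact (hφ'.trans (hs.prod (QuadraticMap.Equivalent.refl _))).trans
    (equivalent_anisotropicPart_prod ψ).symm

/-- Minimality of the anisotropic part, in terms of the space of values. -/
theorem wedgeFactors_valueSpace [FiniteDimensional F V] {φ : QuadraticForm F V}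
    (hφ : IsTotallySingular φ) (hmin : IsMinimal (anisotropicPart φ)) :
    WedgeFactors (valueSpace φ hφ) ∧ 0 < Module.finrank (squares F) (valueSpace φ hφ) := by
  obtain ⟨hani, hpos, hdeg⟩ := hmin
  have hfr := finrank_valueSpace_of_anisotropic hφ.anisotropicPart hani
  rw [← valueSpace_anisotropicPart hφ]
  refine ⟨wedgeFactors_of_finrank_adjoin _ (hfr ▸ hpos) ?_, hfr ▸ hpos⟩
  rw [hfr, ← hdeg, normDegree]
  refine le_of_eq (congrArg (fun K : IntermediateField (squares F) F =>
    Module.finrank (squares F) K) (le_antisymm ?_ ?_))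
  · refine IntermediateField.adjoin_le_iff.mpr ?_
    rintro _ ⟨v, w, -, -, rfl⟩
    exact IntermediateField.subset_adjoin _ _ ⟨_, ⟨v, rfl⟩, _, ⟨w, rfl⟩, rfl⟩
  · refine IntermediateField.adjoin_le_iff.mpr ?_
    rintro _ ⟨_, ⟨v, rfl⟩, _, ⟨w, rfl⟩, rfl⟩
    by_cases hv : anisotropicPart φ v = 0
    · rw [hv, zero_div]; exact zero_mem _
    by_cases hw : anisotropicPart φ w = 0
    · rw [hw, div_zero]; exact zero_mem _
    exact IntermediateField.subset_adjoin _ _ ⟨v, w, hv, hw, rfl⟩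

end Values

/-! ### Quadratic extensions -/

section ScalarExtension

variable {F : Type u} [Field F] [CharP F 2] {V : Type v} [AddCommGroup V] [Module F V]
  {W : Type w} [AddCommGroup W] [Module F W]

/-- `F(√0) = F`. -/
theorem defect_baseChange_sqrtExtension_zero [FiniteDimensional F V] (φ : QuadraticForm F V)
    (hφ : IsTotallySingular φ) : defect (baseChange (sqrtExtension (0 : F)) φ hφ) = defect φ := by
  have hfr : Module.finrank F (sqrtExtension (0 : F)) = 1 := by
    rw [sqrtExtension_zero, IntermediateField.finrank_bot]
  have hfin : FiniteDimensional F (sqrtExtension (0 : F)) :=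
    Module.finite_of_finrank_pos (by rw [hfr]; exact one_pos)
  let g : V →ₗ[F] sqrtExtension (0 : F) ⊗[F] V := TensorProduct.mk F _ V 1
  have hs : Function.Surjective g := by
    intro x
    induction x using TensorProduct.induction_on with
    | zero => exact ⟨0, map_zero g⟩
    | tmul e v =>
      have hbot : (e : AlgebraicClosure F) ∈ (⊥ : IntermediateField F (AlgebraicClosure F)) := by
        rw [← sqrtExtension_zero]; exact e.2
      obtain ⟨s, hs⟩ := IntermediateField.mem_bot.mp hbot
      have he : e = s • (1 : sqrtExtension (0 : F)) := Subtype.ext (by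
        rw [← hs]; simp [Algebra.smul_def])
      exact ⟨s • v, by rw [he, TensorProduct.smul_tmul]; rfl⟩
    | add x y hx hy =>
      obtain ⟨⟨x, rfl⟩, ⟨y, rfl⟩⟩ := hx, hy
      exact ⟨x + y, map_add g x y⟩
  have hi : Function.Injective g := (LinearMap.injective_iff_surjective_of_finrank_eq_finrank (by
    rw [Module.finrank_tensorProduct, hfr, one_mul])).mpr hs
  have := finrank_mul_defect (baseChange_isTotallySingular (sqrtExtension (0 : F)) φ hφ) hφ
    (LinearEquiv.ofBijective g ⟨hi, hs⟩) (fun v => by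
      change baseChange _ φ hφ (1 ⊗ₜ v) = _
      rw [baseChange_tmul, one_pow, one_mul])
  rwa [hfr, one_mul] at this

theorem exists_sqrtExtension_eq_adjoin (a : F) :
    ∃ r : AlgebraicClosure F, r ^ 2 = algebraMap F _ a ∧
      sqrtExtension a = IntermediateField.adjoin F {r} := by
  obtain ⟨r, hr⟩ := IsAlgClosed.exists_pow_nat_eq (algebraMap F (AlgebraicClosure F) a) two_pos
  have : CharP (AlgebraicClosure F) 2 :=
    charP_of_injective_algebraMap (algebraMap F (AlgebraicClosure F)).injective 2
  refine ⟨r, hr, ?_⟩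
  rw [sqrtExtension, ← hr]
  congr 1
  ext x
  exact ⟨fun h => frobenius_inj (AlgebraicClosure F) 2 h,
    fun h => by rw [Set.mem_singleton_iff.mp h]; rfl⟩

theorem finrank_sqrtExtension {a : F} (ha : a ∉ squares F) :
    Module.finrank F (sqrtExtension a) = 2 := by
  obtain ⟨r, hr, h⟩ := exists_sqrtExtension_eq_adjoin a
  have hirr : Irreducible (Polynomial.X ^ 2 - Polynomial.C a) :=
    X_pow_sub_C_irreducible_of_prime Nat.prime_two
      (fun b hb => ha (mem_squares_iff.mpr ⟨b, hb⟩))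
  have hint : IsIntegral F r := Algebra.IsIntegral.isIntegral r
  rw [h, IntermediateField.adjoin.finrank hint,
    ← minpoly.eq_of_irreducible_of_monic hirr (by simp [hr])
      (Polynomial.monic_X_pow_sub_C a two_ne_zero), Polynomial.natDegree_X_pow_sub_C]

/-- If `a` is not a square, then `φ_{F(√a)}`, seen over `F`, is the form `φ ⟂ a φ`, through
`(v, w) ↦ 1 ⊗ v + √a ⊗ w`. -/
theorem two_mul_defect_baseChange_sqrtExtension [FiniteDimensional F V] (φ : QuadraticForm F V)
    (hφ : IsTotallySingular φ) {a : F} (ha : a ∉ squares F) :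
    2 * defect (baseChange (sqrtExtension a) φ hφ) = defect (φ.prod (a • φ)) := by
  have hfr := finrank_sqrtExtension ha
  have hfin : FiniteDimensional F (sqrtExtension a) :=
    Module.finite_of_finrank_pos (by rw [hfr]; exact two_pos)
  obtain ⟨r, hr⟩ : ∃ r : sqrtExtension a, r ^ 2 = algebraMap F _ a := by
    obtain ⟨r, hr, h⟩ := exists_sqrtExtension_eq_adjoin a
    exact ⟨⟨r, h ▸ IntermediateField.mem_adjoin_simple_self F r⟩, Subtype.ext hr⟩
  have hli : LinearIndependent F ![(1 : sqrtExtension a), r] := by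
    rw [LinearIndependent.pair_iff' one_ne_zero]
    intro s hs
    refine ha (mem_squares_iff.mpr ⟨s, (algebraMap F (sqrtExtension a)).injective ?_⟩)
    rw [← hr, ← hs, map_pow, Algebra.smul_def, mul_one]
  have hspan := hli.span_eq_top_of_card_eq_finrank (by rw [hfr, Fintype.card_fin])
  rw [Matrix.range_cons_cons_empty] at hspan
  let g : V × V →ₗ[F] sqrtExtension a ⊗[F] V :=
    (TensorProduct.mk F _ V 1).coprod (TensorProduct.mk F _ V r)
  have hg : ∀ v w, g (v, w) = 1 ⊗ₜ v + r ⊗ₜ w := fun v w => rfl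
  have hs : Function.Surjective g := by
    intro x
    induction x using TensorProduct.induction_on with
    | zero => exact ⟨0, map_zero g⟩
    | tmul e v =>
      have he : e ∈ Submodule.span F {1, r} := hspan ▸ Submodule.mem_top
      obtain ⟨s, t, rfl⟩ := Submodule.mem_span_pair.mp he
      exact ⟨(s • v, t • v), by
        rw [hg, TensorProduct.add_tmul, TensorProduct.smul_tmul, TensorProduct.smul_tmul]⟩
    | add x y hx hy =>
      obtain ⟨⟨x, rfl⟩, ⟨y, rfl⟩⟩ := hx, hy
      exact ⟨x + y, map_add g x y⟩
  have hi : Function.Injective g := (LinearMap.injective_iff_surjective_of_finrank_eq_finrank (by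
    rw [Module.finrank_tensorProduct, hfr, Module.finrank_prod, two_mul])).mpr hs
  rw [← hfr]
  refine finrank_mul_defect (baseChange_isTotallySingular (sqrtExtension a) φ hφ)
    (hφ.prod (hφ.smul a))
    (LinearEquiv.ofBijective g ⟨hi, hs⟩) ?_
  rintro ⟨v, w⟩
  change baseChange _ φ hφ (g (v, w)) = _
  rw [hg, (baseChange_isTotallySingular _ φ hφ).map_add, baseChange_tmul, baseChange_tmul, hr,
    one_pow, one_mul, ← map_mul, ← map_add]
  rfl

/-- The defect over `F(√a)` measures the overlap of the space of values `S` with `a S`. -/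
theorem finrank_valueSpace_inf_smul [FiniteDimensional F V] (φ : QuadraticForm F V)
    (hφ : IsTotallySingular φ) {a : F} (ha : a ∉ squares F) :
    Module.finrank (squares F) (valueSpace φ hφ ⊓ a • valueSpace φ hφ : Submodule _ F)
        + 2 * defect φ = 2 * defect (baseChange (sqrtExtension a) φ hφ) := by
  have ha0 : a ≠ 0 := fun h => ha (h ▸ zero_mem _)
  have h1 := finrank_valueSpace_add_defect (φ.prod (a • φ)) (hφ.prod (hφ.smul a))
  have h2 := finrank_valueSpace_add_defect φ hφ
  have : FiniteDimensional (squares F) (a • valueSpace φ hφ : Submodule (squares F) F) :=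
    Module.Finite.map _ (LinearMap.mulLeft (squares F) a)
  have h3 := Submodule.finrank_sup_add_finrank_inf_eq (valueSpace φ hφ) (a • valueSpace φ hφ)
  rw [valueSpace_prod hφ (hφ.smul a), valueSpace_smul hφ, Module.finrank_prod,
    ← two_mul_defect_baseChange_sqrtExtension φ hφ ha] at h1
  rw [finrank_smul ha0] at h3
  omega

end ScalarExtension

/-! ### Weak Vishik equivalence and similarity -/

theorem WeaklyVishikEquivalent.similar {F : Type u} [Field F] [CharP F 2]
    {V : Type v} [AddCommGroup V] [Module F V] [FiniteDimensional F V]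
    {W : Type w} [AddCommGroup W] [Module F W] [FiniteDimensional F W]
    {φ : QuadraticForm F V} {hφ : IsTotallySingular φ}
    {ψ : QuadraticForm F W} {hψ : IsTotallySingular ψ}
    (h : WeaklyVishikEquivalent φ hφ ψ hψ) (hmin : IsMinimal (anisotropicPart φ)) :
    Similar φ ψ := by
  obtain ⟨hdim, hdef⟩ := h
  have h0 := hdef 0
  rw [defect_baseChange_sqrtExtension_zero, defect_baseChange_sqrtExtension_zero] at h0
  have h1 := finrank_valueSpace_add_defect φ hφ
  have h2 := finrank_valueSpace_add_defect ψ hψ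
  obtain ⟨hwedge, hpos⟩ := wedgeFactors_valueSpace hφ hmin
  obtain ⟨c, hc, hST⟩ := hwedge.eq_smul (T := valueSpace ψ hψ) hpos (by omega) (fun a ha => by
    have h3 := finrank_valueSpace_inf_smul φ hφ ha
    have h4 := finrank_valueSpace_inf_smul ψ hψ ha
    have h5 := hdef a
    omega)
  exact ⟨c, hc, equivalent_of_valueSpace_eq (hφ := hφ) (hψ := hψ.smul c) hdim
    (by rw [hST, valueSpace_smul hψ])⟩

end TSForm

theorem mainTheorem1 {F : Type u} [Field F] [CharP F 2]
    {V : Type v} [AddCommGroup V] [Module F V] [FiniteDimensional F V]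
    {W : Type w} [AddCommGroup W] [Module F W] [FiniteDimensional F W]
    (φ : QuadraticForm F V) (hφ : TSForm.IsTotallySingular φ)
    (ψ : QuadraticForm F W) (hψ : TSForm.IsTotallySingular ψ)
    (hmin : TSForm.IsMinimal (TSForm.anisotropicPart φ)) :
    (TSForm.WeaklyVishikEquivalent φ hφ ψ hψ → TSForm.Similar φ ψ) ∧
      (TSForm.VishikEquivalent φ hφ ψ hψ → TSForm.Similar φ ψ) :=
  ⟨fun h => h.similar hmin, fun h =>
    TSForm.WeaklyVishikEquivalent.similar ⟨h.1, fun a => h.2 (TSForm.sqrtExtension a)⟩ hmin⟩
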